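/- Let $n \ge 1$ and $w = 1^n0^n$, a bit string indexed by $\mathbb{Z}/2n$. In the (symmetrized) ordered search problem for lists of length $n$, the input is a translate $y = T^j w$, i.e. $y_i = w_{i-j}$, with $j \in \mathbb{Z}/2n$ unknown, and the task is to output $j \bmod n$. (For $0 \le j < n$, $y$ is $x = 0^j1^{n-j}$ followed by its bitwise negation.) The input is accessed through the phase oracle $O_y|i\rangle = (-1)^{y_i}|i\rangle$ on $\mathbb{C}^{2n}$. A $k$-query translation-invariant algorithm for lists of length $n$ is given by unitaries $U_1,\dots,U_k$ on a single register $\mathbb{C}^{2n}$ (no workspace) that commute with the translation operator $T|i\rangle = |i+1\rangle$, i.e. $TU_tT^{-1} = U_t$ for all $t$. On input $y$ it prepares the state $$|\psi_k^{(y)}\rangle = U_k O_y U_{k-1} O_y \cdots U_1 O_y |\psi_0\rangle, \qquad |\psi_0\rangle = \frac{1}{\sqrt{2n}}\sum_{i \in \mathbb{Z}/2n} |i\rangle,$$ and measures with the orthogonal projectors $\Pi_j = |\phi_j\rangle\langle\phi_j|$, where $|\phi_j\rangle = \frac{1}{\sqrt2}\left(|j\rangle + (-1)^k|j+n\rangle\right)$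 for $j = 0,\dots,n-1$. The algorithm has error $\varepsilon$ if $$\left\| \Pi_{j \bmod n}\, |\psi_k^{(T^jw)}\rangle \right\|^2 \ge 1-\varepsilon \qquad \text{for all } j \in \mathbb{Z}/2n.$$ **Corollary.** Let $\varepsilon \ge 0$, $k \ge 0$ and $1 \le m < n$. If there is an $\varepsilon$-error $k$-query translation-invariant algorithm for lists of length $n$, then there is also an $\varepsilon$-error $k$-query translation-invariant algorithm for lists of length $m$. -/

import Mathlib

open scoped Matrix

namespace OrderedSearch

noncomputable section

/-- The cyclic translation operator `T |j⟩ = |j + 1⟩` on the register with basis `ℤ/2n`. -/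
def translation (n : ℕ) : Matrix (ZMod (2 * n)) (ZMod (2 * n)) ℂ :=
  Matrix.of fun i j => if i = j + 1 then 1 else 0

/-- The bits of the string `w = 1ⁿ0ⁿ`, indexed by `ℤ/2n`. -/
def baseString (n : ℕ) : ZMod (2 * n) → Bool :=
  fun i => decide (i.val < n)

/-- The instances of the (symmetrized) ordered search problem: the translates `T^j w` of
`w = 1ⁿ0ⁿ`, so that `(T^j w)_i = w_{i-j}`. For `0 ≤ j < n` this is `x` followed by its bitwise
negation, where `x = 0^j 1^{n-j}`. The required answer is `j mod n`. -/
def inputString (n : ℕ) (j : ZMod (2 * n)) : ZMod (2 * n) → Bool :=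
  fun i => baseString n (i - j)

/-- The phase oracle `O_y |i⟩ = (-1)^{y_i} |i⟩`. -/
def phaseOracle {n : ℕ} (y : ZMod (2 * n) → Bool) : Matrix (ZMod (2 * n)) (ZMod (2 * n)) ℂ :=
  Matrix.diagonal fun i => (-1) ^ (y i).toNat

/-- A `k`-query quantum algorithm for the `n`-element ordered search problem operating on a single
register of dimension `2n` (no workspace): a unit initial state, unitaries `U₁, …, U_k`
(here `U t` is `U_{t+1}`), and a measurement, given by orthogonal projectors indexed by the
possible answers, with pairwise orthogonal ranges. -/
structure QueryAlgorithm (n k : ℕ) [NeZero n] where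
  init : ZMod (2 * n) → ℂ
  norm_init : ‖WithLp.toLp 2 init‖ = 1
  U : Fin k → Matrix.unitaryGroup (ZMod (2 * n)) ℂ
  proj : ZMod n → Matrix (ZMod (2 * n)) (ZMod (2 * n)) ℂ
  isStarProjection_proj : ∀ j, IsStarProjection (proj j)
  proj_mul_proj : Pairwise fun i j => proj i * proj j = 0

namespace QueryAlgorithm

variable {n k : ℕ} [NeZero n]

/-- The state `U_t O_y U_{t-1} ⋯ U_1 O_y |ψ₀⟩` after `t ≤ k` queries, on input `y`. -/
def state (A : QueryAlgorithm n k) (y : ZMod (2 * n) → Bool) :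
    (t : ℕ) → t ≤ k → (ZMod (2 * n) → ℂ)
  | 0, _ => A.init
  | t + 1, h => (A.U ⟨t, h⟩).1 *ᵥ (phaseOracle y *ᵥ A.state y t (Nat.le_of_succ_le h))

/-- The final state of the algorithm on input `y`. -/
def finalState (A : QueryAlgorithm n k) (y : ZMod (2 * n) → Bool) : ZMod (2 * n) → ℂ :=
  A.state y k le_rfl

/-- The algorithm solves ordered search with error `ε`: on every input `T^j w`, the answer `j mod n`
is measured with probability at least `1 - ε`. -/
def SolvesWithError (A : QueryAlgorithm n k) (ε : ℝ) : Prop :=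
  ∀ j : ZMod (2 * n),
    1 - ε ≤ ‖WithLp.toLp 2 (A.proj (j.val : ZMod n) *ᵥ A.finalState (inputString n j))‖ ^ 2

end QueryAlgorithm

/-- The measurement vector `|φ_j⟩ = (|j⟩ + (-1)^k |j + n⟩) / √2`, for `j = 0, …, n - 1`. -/
def measurementVector (n k : ℕ) (j : ZMod n) : ZMod (2 * n) → ℂ :=
  ((1 / Real.sqrt 2 : ℝ) : ℂ) •
    (Pi.single (j.val : ZMod (2 * n)) 1 + (-1 : ℂ) ^ k • Pi.single ((j.val + n : ℕ) : ZMod (2 * n)) 1)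

/-- Translation-invariant algorithms: the initial state is the uniform superposition, every unitary
commutes with the translation operator, and the answer `j` is measured by `|φ_j⟩⟨φ_j|`. (That there
is a single register of dimension `2n` is built into `QueryAlgorithm`.) -/
structure QueryAlgorithm.IsTranslationInvariant {n k : ℕ} [NeZero n]
    (A : QueryAlgorithm n k) : Prop where
  init_eq : A.init = fun _ => ((1 / Real.sqrt (2 * n) : ℝ) : ℂ)
  conj_translation : ∀ t, translation n * (A.U t).1 * (translation n)⁻¹ = (A.U t).1
  proj_eq : ∀ j, A.proj j =
    Matrix.vecMulVec (measurementVector n k j) (star (measurementVector n k j))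

/-- There is an `ε`-error `k`-query translation-invariant algorithm for lists of length `n`. -/
def HasTranslationInvariantAlgorithm (n k : ℕ) [NeZero n] (ε : ℝ) : Prop :=
  ∃ A : QueryAlgorithm n k, A.IsTranslationInvariant ∧ A.SolvesWithError ε

end

end OrderedSearch

namespace OrderedSearch

open Matrix

open scoped ComplexOrder

/-! ### Positive semidefinite matrices and splitting off a rank-one pivot. -/

section Matrices

variable {ι : Type*}

/-! Both directions pass through polynomials: a translation-invariant algorithm for length `m` can
be built from a chain of polynomials `g_0, …, g_k` of degree less than `m`, with `g_0` uniform,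
`|g_{t+1}| = |g_t|` at the roots of `z^m = (-1)^(t+1)`, and `|g_k(0)|² ≥ 1 - ε`
(`HasPolynomialChain`).

To get the chain from an algorithm for length `n`, run it on the inputs `T^j w` with `0 ≤ j < m`. Up
to a sign depending only on `i`, the bit at position `i` compares `j` with one position `p` of the
short list. For each `i`, the amplitudes over `j` become a polynomial in the index `p - j` mod `m`,
with a sign `(-1)^t` on wraparound. The sum over `i` of their squared moduli, divided by `m`, is a
nonnegative trigonometric polynomial. At the relevant roots the wraparound sign absorbs the oracle,
and the unitary drops out because it commutes with translations and preserves norms; hence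
consecutive trigonometric polynomials agree there (`sum_norm_sq_eval_localVector_step`).

The workspace index `i` is then removed by an extremal Fejér-Riesz factorization
(`exists_vector_sameDiagonalSums`): each trigonometric polynomial is a single `|g_t|²`, and the
constant term, which bounds the success probability, does not decrease.

Conversely, `g_t` followed by `(-1)^t g_t` is a state on `ℤ/2m`. A query flips the sign between the
halves, which moves the Fourier support to the roots where the chain prescribes equal moduli; a
circulant unitary then adjusts the phases. -/

theorem normSq_apply_le_of_posSemidef {G : Matrix ι ι ℂ} (hG : G.PosSemidef) (a b : ι) :
    Complex.normSq (G a b) ≤ (G a a).re * (G b b).re := by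
  have h := (hG.submatrix ![a, b]).det_nonneg
  have ha := (hG.diag_nonneg (i := a))
  have hb := (hG.diag_nonneg (i := b))
  rw [det_fin_two] at h
  simp only [submatrix_apply, cons_val_zero, cons_val_one] at h
  have hs : G b a = star (G a b) := (hG.1.apply b a).symm
  rw [hs, Complex.le_def] at h
  rw [Complex.le_def] at ha hb
  have h1 := h.1
  simp only [Complex.zero_re, Complex.sub_re, Complex.mul_re, Complex.star_def, Complex.conj_re,
    Complex.conj_im] at h1
  simp only [Complex.zero_im] at ha hb
  rw [← ha.2, ← hb.2] at h1
  rw [Complex.normSq_apply]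
  linarith

/-- One step of symmetric Gaussian elimination, realized as a congruence of `G`. If the pivot
vanishes, `0⁻¹ = 0` makes the subtracted term zero. -/
theorem posSemidef_sub_vecMulVec [Fintype ι] [DecidableEq ι] {G : Matrix ι ι ℂ} (hG : G.PosSemidef) (i : ι) :
    (G - vecMulVec (fun a => G a i) (fun b => (G i i)⁻¹ * G i b)).PosSemidef := by
  have h := hG.conjTranspose_mul_mul_same
    (1 - vecMulVec (Pi.single i 1) (fun b => (G i i)⁻¹ * G i b) : Matrix ι ι ℂ)
  convert h using 1
  rw [mul_assoc, mul_sub, mul_one, mul_vecMulVec, mulVec_single_one, conjTranspose_sub,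
    conjTranspose_one, sub_mul, one_mul, conjTranspose_vecMulVec, vecMulVec_mul]
  suffices hz : vecMulVec (star fun b => (G i i)⁻¹ * G i b) (star (Pi.single i 1 : ι → ℂ) ᵥ*
      (G - vecMulVec (G.col i) fun b => (G i i)⁻¹ * G i b)) = 0 by
    rw [hz, sub_zero]; rfl
  have hs : star (Pi.single i 1 : ι → ℂ) = Pi.single i 1 := by
    rw [← Pi.single_star, star_one]
  rw [hs]
  ext a b
  rw [single_one_vecMul]
  by_cases h0 : G i i = 0
  · simp [vecMulVec_apply, h0]
  · simp [vecMulVec_apply, mul_inv_cancel_left₀ h0]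

/-- The vector `g` with `g g*` the rank-one part of `G` split off by pivoting at `i`. -/
noncomputable def pivotVector (G : Matrix ι ι ℂ) (i : ι) : ι → ℂ :=
  fun a => G a i / (Real.sqrt (G i i).re : ℂ)

theorem vecMulVec_pivotVector {G : Matrix ι ι ℂ} (hG : G.PosSemidef) (i : ι) :
    vecMulVec (pivotVector G i) (star (pivotVector G i)) =
      vecMulVec (fun a => G a i) (fun b => (G i i)⁻¹ * G i b) := by
  have hd := hG.diag_nonneg (i := i)
  rw [Complex.le_def] at hd
  have hre : G i i = ((G i i).re : ℂ) := Complex.ext rfl hd.2.symm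
  have hsq : ((Real.sqrt (G i i).re : ℝ) : ℂ) * (Real.sqrt (G i i).re : ℂ) = G i i := by
    rw [← Complex.ofReal_mul, Real.mul_self_sqrt hd.1, ← hre]
  ext a b
  simp only [vecMulVec_apply, pivotVector, Pi.star_apply, star_div₀, Complex.star_def,
    Complex.conj_ofReal]
  rw [show (starRingEnd ℂ) (G b i) = G i b from hG.1.apply i b,
    show (G i i)⁻¹ = (Real.sqrt (G i i).re : ℂ)⁻¹ * (Real.sqrt (G i i).re : ℂ)⁻¹ by
      rw [← mul_inv, hsq]]
  ring

end Matrices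

/-! ### Extremal Fejér-Riesz factorization. -/

section Extremal

variable {m : ℕ}

/-- Two square matrices have the same sums along each diagonal. -/
def SameDiagonalSums (G H : Matrix (Fin m) (Fin m) ℂ) : Prop :=
  ∀ φ : ℤ → ℂ, ∑ a, ∑ b, G a b * φ ((a : ℕ) - (b : ℕ) : ℤ) =
    ∑ a, ∑ b, H a b * φ ((a : ℕ) - (b : ℕ) : ℤ)

theorem SameDiagonalSums.trace_eq {G H : Matrix (Fin m) (Fin m) ℂ} (h : SameDiagonalSums G H) :
    G.trace = H.trace := by
  have := h (fun d => if d = 0 then 1 else 0)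
  simpa [sub_eq_zero, Fin.val_inj, Matrix.trace] using this

/-- The zeroth diagonal sum fixes the trace, and the entries of a positive semidefinite matrix are
bounded by its trace; the defining conditions are closed. -/
theorem isCompact_sameDiagonalSums (A : Matrix (Fin m) (Fin m) ℂ) :
    IsCompact {G : Matrix (Fin m) (Fin m) ℂ | G.PosSemidef ∧ SameDiagonalSums G A} := by
  have hsub : {G : Matrix (Fin m) (Fin m) ℂ | G.PosSemidef ∧ SameDiagonalSums G A} ⊆
      Set.pi Set.univ fun _ => Set.pi Set.univ fun _ => Metric.closedBall (0 : ℂ) A.trace.re := by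
    rintro G ⟨hG, hs⟩ a - b -
    have hd : ∀ i, 0 ≤ (G i i).re := fun i => (Complex.le_def.1 (hG.diag_nonneg (i := i))).1
    have htr : ∑ i, (G i i).re = A.trace.re := by
      rw [← hs.trace_eq, Matrix.trace, Complex.re_sum]; rfl
    have hle : ∀ i, (G i i).re ≤ A.trace.re := fun i => by
      rw [← htr]; exact Finset.single_le_sum (f := fun i => (G i i).re) (fun i _ => hd i) (Finset.mem_univ i)
    rw [mem_closedBall_zero_iff]
    refine abs_le_of_sq_le_sq ?_ ((hd a).trans (hle a)) |> fun h => (le_abs_self _).trans h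
    rw [← Complex.normSq_eq_norm_sq, sq]
    exact (normSq_apply_le_of_posSemidef hG a b).trans
      (mul_le_mul (hle a) (hle b) (hd b) ((hd a).trans (hle a)))
  refine IsCompact.of_isClosed_subset
    (isCompact_univ_pi fun _ => isCompact_univ_pi fun _ => isCompact_closedBall _ _) ?_ hsub
  have hset : {G : Matrix (Fin m) (Fin m) ℂ | G.PosSemidef ∧ SameDiagonalSums G A} =
      {G | Gᴴ = G} ∩ (⋂ x : Fin m → ℂ, {G | 0 ≤ star x ⬝ᵥ (G *ᵥ x)}) ∩
        ⋂ φ : ℤ → ℂ, {G | ∑ a, ∑ b, G a b * φ ((a : ℕ) - (b : ℕ) : ℤ) =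
          ∑ a, ∑ b, A a b * φ ((a : ℕ) - (b : ℕ) : ℤ)} := by
    ext G
    simp only [Set.mem_ofPred_eq, Set.mem_inter_iff, Set.mem_iInter,
      posSemidef_iff_dotProduct_mulVec, SameDiagonalSums, IsHermitian]
  rw [hset]
  refine ((isClosed_eq (by fun_prop) (by fun_prop)).inter (isClosed_iInter fun x => ?_)).inter
    (isClosed_iInter fun φ => isClosed_eq (by fun_prop) (by fun_prop))
  exact isClosed_le continuous_const (by fun_prop)

variable [NeZero m]

/-- The cyclic shift moves entries along their diagonals, except for those that wrap around; these
come from the first `i` rows or columns, which vanish. -/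
theorem sameDiagonalSums_submatrix_add {R : Matrix (Fin m) (Fin m) ℂ} (i : Fin m)
    (hrow : ∀ a < i, ∀ b, R a b = 0) (hcol : ∀ b < i, ∀ a, R a b = 0) :
    SameDiagonalSums (R.submatrix (· + i) (· + i)) R := by
  intro φ
  rw [← Equiv.sum_comp (Equiv.addRight i)
    (fun a : Fin m => ∑ b, R a b * φ ((a : ℕ) - (b : ℕ) : ℤ))]
  refine Finset.sum_congr rfl fun a _ => ?_
  rw [Equiv.coe_addRight, ← Equiv.sum_comp (Equiv.addRight i)
    (fun b : Fin m => R (a + i) b * φ (((a + i : Fin m) : ℕ) - (b : ℕ) : ℤ))]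
  refine Finset.sum_congr rfl fun b _ => ?_
  simp only [Equiv.coe_addRight, submatrix_apply]
  have key : ∀ x : Fin m, i ≤ x + i → ((x + i : Fin m) : ℕ) = x + i := fun x hx => by
    rw [Fin.le_def, Fin.val_add_eq_ite] at hx
    rw [Fin.val_add_eq_ite]
    split_ifs at hx ⊢ <;> omega
  by_cases ha : a + i < i
  · rw [hrow _ ha]; simp
  by_cases hb : b + i < i
  · rw [hcol _ hb]; simp
  rw [key a (not_lt.1 ha), key b (not_lt.1 hb)]
  congr 2
  push_cast
  ring

/-- Extremal Fejér-Riesz factorization: a nonnegative trigonometric polynomial given by a Gram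
matrix `A` is the squared modulus of a polynomial whose constant term is at least as large as that
of the Gram representation. -/
theorem exists_vector_sameDiagonalSums {A : Matrix (Fin m) (Fin m) ℂ} (hA : A.PosSemidef) :
    ∃ g : Fin m → ℂ, SameDiagonalSums (vecMulVec g (star g)) A ∧ (A 0 0).re ≤ ‖g 0‖ ^ 2 := by
  obtain ⟨G, ⟨hG, hs⟩, hmax⟩ := (isCompact_sameDiagonalSums A).exists_isMaxOn
    ⟨A, hA, fun _ => rfl⟩ (f := fun G => (G 0 0).re) (by fun_prop)
  set g := pivotVector G 0 with hg
  set R := G - vecMulVec g (star g) with hRdef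
  have hR : R.PosSemidef := by
    rw [hRdef, hg, vecMulVec_pivotVector hG]
    exact posSemidef_sub_vecMulVec hG 0
  have hR00 : R 0 0 = 0 := by
    rw [hRdef, hg, vecMulVec_pivotVector hG, Matrix.sub_apply, vecMulVec_apply]
    by_cases h0 : G 0 0 = 0
    · simp [h0]
    · rw [inv_mul_cancel₀ h0, mul_one, sub_self]
  have hzero : ∀ i, R i i = 0 → ∀ b, R i b = 0 ∧ R b i = 0 := fun i hi b => by
    have h1 := normSq_apply_le_of_posSemidef hR i b
    have h2 := normSq_apply_le_of_posSemidef hR b i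
    rw [hi, Complex.zero_re, zero_mul] at h1
    rw [hi, Complex.zero_re, mul_zero] at h2
    exact ⟨Complex.normSq_eq_zero.1 (h1.antisymm (Complex.normSq_nonneg _)),
      Complex.normSq_eq_zero.1 (h2.antisymm (Complex.normSq_nonneg _))⟩
  have hdiag : ∀ i, R i i = 0 := by
    intro i
    induction i using WellFoundedLT.induction with
    | ind i ih =>
      -- Shifting the remainder `R` by `i` gives a competitor whose corner exceeds that of `G` by `R
      -- i i`, since `R 0 0 = 0`. Maximality therefore forces `R i i = 0`.
      have hsh := sameDiagonalSums_submatrix_add i (fun a ha b => (hzero a (ih a ha) b).1)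
        (fun b hb a => (hzero b (ih b hb) a).2)
      have hmem : (vecMulVec g (star g) + R.submatrix (· + i) (· + i)) ∈
          {G : Matrix (Fin m) (Fin m) ℂ | G.PosSemidef ∧ SameDiagonalSums G A} := by
        refine ⟨(posSemidef_vecMulVec_self_star g).add (hR.submatrix _), fun φ => ?_⟩
        rw [← hs φ]
        have h1 := hsh φ
        simp only [Matrix.add_apply, add_mul, Finset.sum_add_distrib]
        rw [h1, ← Finset.sum_add_distrib]
        simp only [← Finset.sum_add_distrib, ← add_mul, hRdef, Matrix.sub_apply, add_sub_cancel]
      have hle := hmax hmem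
      have hsplit : G 0 0 = vecMulVec g (star g) 0 0 := by
        rw [← sub_eq_zero, ← hR00]; rfl
      simp only [Set.mem_ofPred_eq, Matrix.add_apply, submatrix_apply, zero_add, Complex.add_re] at hle
      rw [hsplit] at hle
      have hd := Complex.le_def.1 (hR.diag_nonneg (i := i))
      refine Complex.ext ?_ hd.2.symm
      have := hd.1
      simp only [Complex.zero_re] at this ⊢
      linarith
  have hGg : G = vecMulVec g (star g) := by
    rw [← sub_eq_zero]
    ext a b
    exact (hzero a (hdiag a) b).1
  refine ⟨g, hGg ▸ hs, ?_⟩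
  have h0 := hmax (a := A) ⟨hA, fun _ => rfl⟩
  simp only [Set.mem_ofPred_eq] at h0
  rw [hGg, vecMulVec_apply, Pi.star_apply, Complex.star_def, Complex.mul_conj,
    Complex.ofReal_re, Complex.normSq_eq_norm_sq] at h0
  exact h0

end Extremal

open ZMod

/-! ### Circulant unitaries and the discrete Fourier transform. -/

section Circulant

variable {N : ℕ} [NeZero N]

theorem dft_circulant_mulVec (c u : ZMod N → ℂ) (k : ZMod N) :
    dft (circulant c *ᵥ u) k = dft c k * dft u k := by
  simp only [dft_apply, mulVec, dotProduct, circulant_apply, smul_eq_mul, Finset.mul_sum,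
    Finset.sum_mul]
  rw [Finset.sum_comm, Finset.sum_comm (γ := ZMod N)]
  rw [Finset.sum_comm]
  refine Finset.sum_congr rfl fun j _ => ?_
  rw [← Equiv.sum_comp (Equiv.addRight j)]
  refine Finset.sum_congr rfl fun i _ => ?_
  rw [Equiv.coe_addRight, add_sub_cancel_right, add_mul, neg_add, AddChar.map_add_eq_mul]
  ring

theorem dft_star_neg (c : ZMod N → ℂ) (k : ZMod N) :
    dft (fun i => star (c (-i))) k = star (dft c k) := by
  simp only [dft_apply, smul_eq_mul, star_sum, star_mul']
  rw [← Equiv.sum_comp (Equiv.neg _)]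
  refine Finset.sum_congr rfl fun i _ => ?_
  rw [Equiv.neg_apply, neg_neg, neg_mul, neg_neg, AddChar.map_neg_eq_conj]
  simp

/-- Vectors whose Fourier coefficients agree in modulus are related by a circulant unitary. -/
theorem exists_circulant_mem_unitaryGroup {u v : ZMod N → ℂ} (h : ∀ k, ‖dft u k‖ = ‖dft v k‖) :
    ∃ c : ZMod N → ℂ, circulant c ∈ unitaryGroup (ZMod N) ℂ ∧ circulant c *ᵥ u = v := by
  -- The eigenvalues of the circulant. Where `dft u` vanishes so does `dft v`, and any unimodular
  -- value would do.
  let d : ZMod N → ℂ := fun k => if dft u k = 0 then 1 else dft v k / dft u k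
  have hd : ∀ k, d k * star (d k) = 1 := fun k => by
    rw [Complex.star_def, Complex.mul_conj, Complex.normSq_eq_norm_sq]
    by_cases hk : dft u k = 0
    · simp [d, hk]
    · have : ‖dft v k‖ ≠ 0 := by rw [← h]; exact norm_ne_zero_iff.2 hk
      simp [d, hk, h k, this]
  refine ⟨dft.symm d, ?_, ?_⟩
  · rw [mem_unitaryGroup_iff, star_eq_conjTranspose, conjTranspose_circulant, circulant_mul,
      ← circulant_single_one ℂ (ZMod N)]
    congr 1
    apply dft.injective
    ext k
    have h1 : dft (Pi.single 0 1 : ZMod N → ℂ) k = 1 := by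
      simp [dft_apply, Pi.single_apply]
    rw [dft_circulant_mulVec, h1, ← hd k]
    have := dft_star_neg (dft.symm d) k
    rw [LinearEquiv.apply_symm_apply] at this ⊢
    rw [← this]
    rfl
  · apply dft.injective
    ext k
    rw [dft_circulant_mulVec, LinearEquiv.apply_symm_apply]
    by_cases hk : dft u k = 0
    · have : ‖dft v k‖ = 0 := by rw [← h, hk, norm_zero]
      rw [hk, mul_zero, norm_eq_zero.1 this]
    · simp [d, hk]

end Circulant

/-! ### Translation invariance means circulant. -/

section Translation

variable {n : ℕ}

theorem translation_eq_circulant : translation n = circulant (Pi.single 1 1) := by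
  ext i j
  simp [translation, circulant_apply, Pi.single_apply, sub_eq_iff_eq_add, add_comm]

variable [NeZero n]

theorem isUnit_det_translation : IsUnit (translation n).det := by
  rw [← Matrix.isUnit_iff_isUnit_det, translation_eq_circulant]
  refine IsUnit.of_mul_eq_one (circulant (Pi.single (-1) 1)) ?_
  rw [circulant_mul, ← circulant_single_one ℂ (ZMod (2 * n))]
  congr 1
  ext i
  simp [circulant_apply, Pi.single_apply, eq_comm]

theorem translation_conj_eq_iff (U : Matrix (ZMod (2 * n)) (ZMod (2 * n)) ℂ) :
    translation n * U * (translation n)⁻¹ = U ↔ ∀ i j, U (i + 1) (j + 1) = U i j := by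
  have h1 : translation n * U * (translation n)⁻¹ = U ↔
      translation n * U = U * translation n := by
    constructor
    · intro h
      nth_rewrite 2 [← h]
      rw [Matrix.nonsing_inv_mul_cancel_right _ _ isUnit_det_translation]
    · intro h
      rw [h, Matrix.mul_nonsing_inv_cancel_right _ _ isUnit_det_translation]
  rw [h1]
  have hL : ∀ i j, (translation n * U) i j = U (i - 1) j := fun i j => by
    simp [Matrix.mul_apply, translation, ← sub_eq_iff_eq_add]
  have hR : ∀ i j, (U * translation n) i j = U i (j + 1) := fun i j => by
    simp [Matrix.mul_apply, translation]
  constructor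
  · intro h i j
    have := congrFun₂ h (i + 1) j
    rw [hL, hR, add_sub_cancel_right] at this
    exact this.symm
  · intro h
    ext i j
    rw [hL, hR, ← h (i - 1) j, sub_add_cancel]

theorem eq_circulant_of_translation_conj {U : Matrix (ZMod (2 * n)) (ZMod (2 * n)) ℂ}
    (h : translation n * U * (translation n)⁻¹ = U) : U = circulant fun i => U i 0 := by
  rw [translation_conj_eq_iff] at h
  have key : ∀ (s : ℕ) i j, U (i + s) (j + s) = U i j := fun s => by
    induction s with
    | zero => simp
    | succ s ih => intro i j; rw [Nat.cast_succ, ← add_assoc, ← add_assoc, h, ih]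
  ext i j
  rw [circulant_apply, ← key j.val (i - j) 0]
  simp

theorem translation_conj_circulant (c : ZMod (2 * n) → ℂ) :
    translation n * circulant c * (translation n)⁻¹ = circulant c := by
  rw [translation_conj_eq_iff]
  intro i j
  simp [circulant_apply]

end Translation

/-! ### Norms and the measurement vectors. -/

section Measurement

theorem sum_zmod_eq_sum_range {N : ℕ} [NeZero N] {M : Type*} [AddCommMonoid M] (f : ZMod N → M) :
    ∑ i, f i = ∑ v ∈ Finset.range N, f v := by
  refine Finset.sum_bij' (fun i _ => i.val) (fun v _ => (v : ZMod N)) ?_ ?_ ?_ ?_ ?_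
  · exact fun i _ => Finset.mem_range.2 (ZMod.val_lt i)
  · simp
  · simp
  · exact fun v hv => ZMod.val_cast_of_lt (Finset.mem_range.1 hv)
  · simp

theorem sum_zmod_two_mul {n : ℕ} [NeZero n] {M : Type*} [AddCommMonoid M] (f : ZMod (2 * n) → M) :
    ∑ i, f i = ∑ v ∈ Finset.range n, f v + ∑ v ∈ Finset.range n, f ((n + v : ℕ) : ZMod (2 * n)) := by
  rw [sum_zmod_eq_sum_range, ← Finset.sum_range_add (fun v => f (v : ZMod (2 * n)))]
  exact Finset.sum_congr (by rw [two_mul]) fun _ _ => rfl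

theorem star_dotProduct_self {ι : Type*} [Fintype ι] (y : ι → ℂ) :
    star y ⬝ᵥ y = ((∑ i, ‖y i‖ ^ 2 : ℝ) : ℂ) := by
  rw [dotProduct, Complex.ofReal_sum]
  refine Finset.sum_congr rfl fun i _ => ?_
  rw [Pi.star_apply, Complex.star_def, mul_comm, Complex.mul_conj, Complex.normSq_eq_norm_sq]

theorem sum_norm_sq_mulVec {ι : Type*} [Fintype ι] [DecidableEq ι] {U : Matrix ι ι ℂ}
    (hU : U ∈ unitaryGroup ι ℂ) (x : ι → ℂ) : ∑ i, ‖(U *ᵥ x) i‖ ^ 2 = ∑ i, ‖x i‖ ^ 2 := by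
  have h : star (U *ᵥ x) ⬝ᵥ (U *ᵥ x) = star x ⬝ᵥ x := by
    rw [star_mulVec, dotProduct_mulVec, vecMul_vecMul, ← star_eq_conjTranspose,
      mem_unitaryGroup_iff'.1 hU, vecMul_one]
  rw [star_dotProduct_self, star_dotProduct_self] at h
  exact_mod_cast h

variable {n : ℕ} [NeZero n]

theorem star_measurementVector_dotProduct (k : ℕ) (j : ZMod n) (x : ZMod (2 * n) → ℂ) :
    star (measurementVector n k j) ⬝ᵥ x = ((1 / Real.sqrt 2 : ℝ) : ℂ) *
      (x (j.val : ZMod (2 * n)) + (-1) ^ k * x ((j.val + n : ℕ) : ZMod (2 * n))) := by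
  rw [measurementVector, star_smul, star_add, star_smul, ← Pi.single_star, ← Pi.single_star,
    smul_dotProduct, add_dotProduct, smul_dotProduct]
  simp

theorem natCast_eq_natCast_of_lt {N a b : ℕ} (ha : a < N) (hb : b < N) :
    (a : ZMod N) = b ↔ a = b := by
  rw [ZMod.natCast_eq_natCast_iff']
  rw [Nat.mod_eq_of_lt ha, Nat.mod_eq_of_lt hb]

theorem star_measurementVector_dotProduct_measurementVector (k : ℕ) (i j : ZMod n) :
    star (measurementVector n k i) ⬝ᵥ measurementVector n k j = if i = j then 1 else 0 := by
  have hi := ZMod.val_lt i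
  have hj := ZMod.val_lt j
  have hs : ((Real.sqrt 2 : ℝ) : ℂ) * (Real.sqrt 2 : ℝ) = 2 := by
    rw [← Complex.ofReal_mul, Real.mul_self_sqrt (by norm_num)]; norm_num
  have hs0 : ((Real.sqrt 2 : ℝ) : ℂ) ≠ 0 := fun h => by simp [h] at hs
  have hk : (-1 : ℂ) ^ k * (-1) ^ k = 1 := by rw [← mul_pow]; simp
  rw [star_measurementVector_dotProduct]
  simp only [measurementVector, Pi.smul_apply, Pi.add_apply, Pi.single_apply, smul_eq_mul]
  have hcast : ∀ a b : ℕ, a < 2 * n → b < 2 * n → ((a : ZMod (2 * n)) = b ↔ a = b) :=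
    fun a b => natCast_eq_natCast_of_lt
  simp only [hcast i.val j.val (by omega) (by omega), hcast i.val (j.val + n) (by omega) (by omega),
    hcast (i.val + n) j.val (by omega) (by omega),
    hcast (i.val + n) (j.val + n) (by omega) (by omega), add_left_inj,
    (ZMod.val_injective n).eq_iff]
  rw [if_neg (show ¬ i.val = j.val + n by omega), if_neg (show ¬ i.val + n = j.val by omega)]
  split_ifs
  · simp only [Complex.ofReal_div, Complex.ofReal_one]
    field_simp
    linear_combination hk - hs
  · simp

theorem norm_sq_vecMulVec_measurementVector_mulVec (k : ℕ) (j : ZMod n) (x : ZMod (2 * n) → ℂ) :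
    ‖WithLp.toLp 2 (vecMulVec (measurementVector n k j) (star (measurementVector n k j)) *ᵥ x)‖ ^ 2 =
      ‖x (j.val : ZMod (2 * n)) + (-1) ^ k * x ((j.val + n : ℕ) : ZMod (2 * n))‖ ^ 2 / 2 := by
  have h1 : ‖WithLp.toLp 2 (measurementVector n k j)‖ ^ 2 = 1 := by
    have h := star_measurementVector_dotProduct_measurementVector k j j
    rw [if_pos rfl, star_dotProduct_self] at h
    rw [EuclideanSpace.norm_sq_eq]
    exact_mod_cast h
  rw [vecMulVec_mulVec, star_measurementVector_dotProduct, op_smul_eq_smul, WithLp.toLp_smul,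
    norm_smul, mul_pow, h1, norm_mul, mul_pow, Complex.norm_real, Real.norm_eq_abs, sq_abs,
    div_pow, Real.sq_sqrt (by norm_num)]
  ring

end Measurement

/-! ### From an algorithm for length `n` to a polynomial chain for length `m`. -/

section Gram

variable {n m : ℕ}

theorem sum_vecMulVec_mul_zpow (g : Fin m → ℂ) {z : ℂ} (hz : ‖z‖ = 1) :
    ∑ a, ∑ b, vecMulVec g (star g) a b * z ^ ((a : ℕ) - (b : ℕ) : ℤ) =
      ((‖∑ a, g a * z ^ (a : ℕ)‖ ^ 2 : ℝ) : ℂ) := by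
  have hz0 : z ≠ 0 := fun h => by simp [h] at hz
  have hinv : z⁻¹ = (starRingEnd ℂ) z := Complex.inv_eq_conj hz
  rw [← Complex.normSq_eq_norm_sq, ← Complex.mul_conj, map_sum, Finset.sum_mul_sum]
  refine Finset.sum_congr rfl fun a _ => Finset.sum_congr rfl fun b _ => ?_
  rw [vecMulVec_apply, Pi.star_apply, Complex.star_def, map_mul, map_pow, ← hinv,
    zpow_sub₀ hz0, zpow_natCast, zpow_natCast, inv_pow]
  ring

variable [NeZero m]

/-- The position in a list of length `m` that is queried in place of position `i` of the symmetrized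
list of length `n`; positions beyond `m - 1` are sent to `m - 1`. -/
def queryPosition (m : ℕ) [NeZero m] (i : ZMod (2 * n)) : Fin m :=
  ⟨min (if i.val < n then i.val else i.val - n) (m - 1),
    (min_le_right _ _).trans_lt (Nat.sub_lt (NeZero.pos m) one_pos)⟩

/-- The amplitudes at position `i`, as the input ranges over the embedded inputs of length `m`. -/
def localVector (m : ℕ) [NeZero m] (σ : ℂ) (u : ZMod (2 * n) → ℂ) (i : ZMod (2 * n)) : Fin m → ℂ :=
  fun a => (if a ≤ queryPosition m i then 1 else σ) *
    u (i - (((queryPosition m i - a : Fin m) : ℕ) : ZMod (2 * n)))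

/-- Substitute `a = p - j` mod `m` and drop the unimodular factor `z ^ p`. Each wraparound
contributes `z ^ m = τ`, so the choice of `τ` decides whether the sign pattern cancels (`σ * τ = 1`)
or imitates the oracle (`σ * τ = -1`). -/
theorem norm_eval_localVector {σ τ : ℂ} {u : ZMod (2 * n) → ℂ} {z : ℂ} (hz : ‖z‖ = 1)
    (hzm : z ^ m = τ) (i : ZMod (2 * n)) :
    ‖∑ a, localVector m σ u i a * z ^ (a : ℕ)‖ =
      ‖∑ j : Fin m, (if j ≤ queryPosition m i then 1 else σ * τ) *
        u (i - ((j : ℕ) : ZMod (2 * n))) * z⁻¹ ^ (j : ℕ)‖ := by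
  have hz0 : z ≠ 0 := fun h => by simp [h] at hz
  set p := queryPosition m i with hp
  have hpz : ∀ x : ℂ, ‖z ^ (p : ℕ) * x‖ = ‖x‖ := fun x => by
    rw [norm_mul, norm_pow, hz, one_pow, one_mul]
  refine Eq.trans ?_ (hpz _)
  rw [Finset.mul_sum, ← Equiv.sum_comp (Equiv.subLeft p)]
  congr 1
  refine Finset.sum_congr rfl fun j _ => ?_
  simp only [localVector, Equiv.subLeft_apply, ← hp, sub_sub_cancel]
  by_cases hj : j ≤ p
  · have hv : ((p - j : Fin m) : ℕ) = p - j := Fin.sub_val_of_le hj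
    have hle : p - j ≤ p := by rw [Fin.le_def, hv]; omega
    rw [if_pos hj, if_pos hle, hv, pow_sub₀ z hz0 hj, inv_pow]
    ring
  · have hv : ((p - j : Fin m) : ℕ) = p + m - j := by
      rw [Fin.coe_sub_iff_lt.2 (not_le.1 hj)]; omega
    have hle : ¬ p - j ≤ p := by rw [Fin.le_def, hv]; omega
    rw [if_neg hj, if_neg hle, hv, pow_sub₀ z hz0 (by omega), pow_add, hzm, inv_pow]
    ring

variable [NeZero n]

/-- The symmetrized Gram matrix of the states of the simulated algorithm. -/
noncomputable def simulationGram (m : ℕ) [NeZero m] (σ : ℂ) (u : ZMod (2 * n) → ℂ) :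
    Matrix (Fin m) (Fin m) ℂ :=
  ∑ i, vecMulVec (((Real.sqrt m)⁻¹ : ℂ) • localVector m σ u i)
    (star (((Real.sqrt m)⁻¹ : ℂ) • localVector m σ u i))

theorem posSemidef_simulationGram (σ : ℂ) (u : ZMod (2 * n) → ℂ) :
    (simulationGram m σ u).PosSemidef :=
  posSemidef_sum _ fun _ _ => posSemidef_vecMulVec_self_star _

theorem norm_sq_eval_eq_of_sameDiagonalSums {σ : ℂ} {u : ZMod (2 * n) → ℂ} {g : Fin m → ℂ}
    (hg : SameDiagonalSums (vecMulVec g (star g)) (simulationGram m σ u)) {z : ℂ} (hz : ‖z‖ = 1) :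
    ‖∑ a, g a * z ^ (a : ℕ)‖ ^ 2 =
      (∑ i, ‖∑ a, localVector m σ u i a * z ^ (a : ℕ)‖ ^ 2) / m := by
  -- Diagonal sums weighted by `z ^ d` are the values of the trigonometric polynomial.
  have h := hg (fun d => z ^ d)
  rw [sum_vecMulVec_mul_zpow g hz] at h
  simp only [simulationGram, Matrix.sum_apply, Finset.sum_mul] at h
  have hswap : ∀ f : Fin m → Fin m → ZMod (2 * n) → ℂ,
      ∑ a, ∑ b, ∑ i, f a b i = ∑ i, ∑ a, ∑ b, f a b i := fun f => by
    rw [Finset.sum_comm]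
    rw [Finset.sum_comm, Finset.sum_comm (γ := ZMod (2 * n))]
    refine Finset.sum_congr rfl fun a _ => Finset.sum_comm
  rw [hswap] at h
  simp only [sum_vecMulVec_mul_zpow _ hz] at h
  rw [← Complex.ofReal_sum, Complex.ofReal_inj] at h
  rw [h, Finset.sum_div]
  refine Finset.sum_congr rfl fun i _ => ?_
  simp only [Pi.smul_apply, smul_eq_mul, mul_assoc]
  rw [← Finset.mul_sum, norm_mul, mul_pow, norm_inv, Complex.norm_real, Real.norm_eq_abs, inv_pow,
    sq_abs, Real.sq_sqrt (Nat.cast_nonneg m)]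
  ring

/-- The first factor does not depend on `j`, so it disappears in the modulus. Truncating `p` at `m -
1` is harmless because `j ≤ m - 1`. -/
theorem baseString_sub_natCast (hmn : m ≤ n) (i : ZMod (2 * n)) (j : Fin m) :
    (-1 : ℂ) ^ (baseString n (i - ((j : ℕ) : ZMod (2 * n)))).toNat =
      (if i.val < n then -1 else 1) * (if j ≤ queryPosition m i then 1 else -1) := by
  have hi := ZMod.val_lt i
  have hj := j.2
  have hcast : i - ((j : ℕ) : ZMod (2 * n)) = ((i.val + 2 * n - j : ℕ) : ZMod (2 * n)) := by
    rw [Nat.cast_sub (by omega), Nat.cast_add, ZMod.natCast_self, add_zero, ZMod.natCast_zmod_val]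
  have hval : (i - ((j : ℕ) : ZMod (2 * n))).val =
      if (j : ℕ) ≤ i.val then i.val - j else i.val + 2 * n - j := by
    rw [hcast, ZMod.val_natCast]
    split_ifs with h
    · rw [Nat.mod_eq_sub_mod (by omega), Nat.mod_eq_of_lt (by omega)]; omega
    · exact Nat.mod_eq_of_lt (by omega)
  rw [baseString, hval]
  simp only [Fin.le_def, queryPosition]
  by_cases h1 : i.val < n
  · by_cases h2 : (j : ℕ) ≤ i.val
    · rw [if_pos h1, if_pos h1, if_pos h2, if_pos (by omega), decide_eq_true (by omega)]; simp
    · rw [if_pos h1, if_pos h1, if_neg h2, if_neg (by omega), decide_eq_false (by omega)]; simp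
  · by_cases h2 : (j : ℕ) ≤ i.val - n
    · rw [if_neg h1, if_neg h1, if_pos (show (j : ℕ) ≤ i.val by omega), if_pos (by omega),
        decide_eq_false (by omega)]
      simp
    · rw [if_neg h1, if_neg h1, if_pos (show (j : ℕ) ≤ i.val by omega), if_neg (by omega),
        decide_eq_true (by omega)]
      simp

theorem sum_norm_sq_eval_localVector_step (hmn : m ≤ n) {c u : ZMod (2 * n) → ℂ}
    (hc : circulant c ∈ unitaryGroup (ZMod (2 * n)) ℂ) {σ z : ℂ} (hσ : σ * σ = 1) (hz : ‖z‖ = 1)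
    (hzm : z ^ m = -σ) :
    ∑ i, ‖∑ a, localVector m (-σ) (circulant c *ᵥ (phaseOracle (inputString n 0) *ᵥ u)) i a *
        z ^ (a : ℕ)‖ ^ 2 =
      ∑ i, ‖∑ a, localVector m σ u i a * z ^ (a : ℕ)‖ ^ 2 := by
  -- `circulant s` is the sum of `z⁻ʲ Tʲ` over `j < m`. It commutes with `circulant c`, so the
  -- unitary can be moved outside and discarded under the norm.
  let s : ZMod (2 * n) → ℂ := ∑ j : Fin m, z⁻¹ ^ (j : ℕ) • Pi.single ((j : ℕ) : ZMod (2 * n)) 1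
  have hs : ∀ (x : ZMod (2 * n) → ℂ) i, (circulant s *ᵥ x) i =
      ∑ j : Fin m, x (i - ((j : ℕ) : ZMod (2 * n))) * z⁻¹ ^ (j : ℕ) := fun x i => by
    simp only [mulVec, dotProduct, circulant_apply, s, Finset.sum_apply, Pi.smul_apply,
      Pi.single_apply, smul_eq_mul, Finset.sum_mul]
    rw [Finset.sum_comm]
    refine Finset.sum_congr rfl fun j _ => ?_
    rw [Finset.sum_eq_single (i - ((j : ℕ) : ZMod (2 * n)))]
    · simp [mul_comm]
    · intro b _ hb
      rw [if_neg (fun h => hb (by rw [← h, sub_sub_cancel]))]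
      simp
    · simp
  have hL : ∀ (x : ZMod (2 * n) → ℂ) i, ‖∑ a, localVector m (-σ) x i a * z ^ (a : ℕ)‖ =
      ‖(circulant s *ᵥ x) i‖ := fun x i => by
    rw [norm_eval_localVector hz hzm, hs]
    simp [hσ]
  have hR : ∀ i, ‖∑ a, localVector m σ u i a * z ^ (a : ℕ)‖ =
      ‖(circulant s *ᵥ (phaseOracle (inputString n 0) *ᵥ u)) i‖ := fun i => by
    rw [norm_eval_localVector hz hzm, hs]
    simp only [phaseOracle, mulVec_diagonal, inputString, sub_zero,
      baseString_sub_natCast hmn, mul_neg, hσ]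
    simp only [mul_assoc, ← Finset.mul_sum]
    rw [norm_mul]
    split_ifs <;> simp
  simp only [hL, hR]
  rw [mulVec_mulVec, circulant_mul_comm, ← mulVec_mulVec, sum_norm_sq_mulVec hc]

theorem simulationGram_const :
    simulationGram m 1 (fun _ : ZMod (2 * n) => ((1 / Real.sqrt (2 * n) : ℝ) : ℂ)) =
      vecMulVec (fun _ => ((1 / Real.sqrt m : ℝ) : ℂ)) (star fun _ => ((1 / Real.sqrt m : ℝ) : ℂ)) := by
  have hn : ((Real.sqrt (2 * n) : ℝ) : ℂ) * (Real.sqrt (2 * n) : ℝ) = 2 * n := by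
    rw [← Complex.ofReal_mul, Real.mul_self_sqrt (by positivity)]; push_cast; rfl
  have hn0 : (n : ℂ) ≠ 0 := Nat.cast_ne_zero.2 (NeZero.ne n)
  ext a b
  simp only [simulationGram, Matrix.sum_apply, vecMulVec_apply, Pi.smul_apply, Pi.star_apply,
    localVector, ite_self, one_mul, smul_eq_mul, Complex.star_def, map_mul, map_inv₀, map_div₀, map_one,
    Complex.conj_ofReal, Finset.sum_const, Finset.card_univ, ZMod.card, nsmul_eq_mul,
    Complex.ofReal_div, Complex.ofReal_one, Nat.cast_mul, Nat.cast_ofNat]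
  rw [← hn]
  have : ((Real.sqrt (2 * n) : ℝ) : ℂ) ≠ 0 := fun h => by
    rw [h, mul_zero] at hn
    exact mul_ne_zero two_ne_zero hn0 hn.symm
  field_simp

/-- In the corner entry, position `i` contributes `‖u (i - p)‖² / m`. The `m` positions `i = v` and
the `m` positions `i = n + v`, with `v < m`, all have `p = v`; the other terms are nonnegative. -/
theorem norm_sq_le_simulationGram (hmn : m ≤ n) (σ : ℂ) (u : ZMod (2 * n) → ℂ) :
    ‖u 0‖ ^ 2 + ‖u n‖ ^ 2 ≤ (simulationGram m σ u 0 0).re := by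
  have hm0 : (0 : ℝ) < m := Nat.cast_pos.2 (NeZero.pos m)
  have hG : (simulationGram m σ u 0 0).re =
      (∑ i, ‖u (i - ((queryPosition m i : ℕ) : ZMod (2 * n)))‖ ^ 2) / m := by
    rw [simulationGram, Matrix.sum_apply, Complex.re_sum, Finset.sum_div]
    refine Finset.sum_congr rfl fun i _ => ?_
    rw [vecMulVec_apply, Pi.star_apply, Complex.star_def, Complex.mul_conj, Complex.ofReal_re,
      Complex.normSq_eq_norm_sq, Pi.smul_apply, smul_eq_mul, norm_mul, mul_pow, norm_inv,
      Complex.norm_real, Real.norm_eq_abs, inv_pow, sq_abs, Real.sq_sqrt (Nat.cast_nonneg m),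
      localVector, if_pos (Fin.zero_le _), one_mul, sub_zero]
    ring
  rw [hG, le_div_iff₀ hm0, sum_zmod_two_mul, add_mul]
  have hsub : Finset.range m ⊆ Finset.range n := Finset.range_mono hmn
  refine add_le_add ?_ ?_
  · refine le_trans (le_of_eq ?_) (Finset.sum_le_sum_of_subset_of_nonneg hsub
      fun _ _ _ => by positivity)
    rw [Finset.sum_congr rfl (g := fun _ => ‖u 0‖ ^ 2), Finset.sum_const, Finset.card_range,
      nsmul_eq_mul, mul_comm]
    intro v hv
    rw [Finset.mem_range] at hv
    have : (queryPosition m (v : ZMod (2 * n)) : ℕ) = v := by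
      simp only [queryPosition, ZMod.val_cast_of_lt (show v < 2 * n by omega)]
      rw [if_pos (by omega)]; omega
    rw [this, sub_self]
  · refine le_trans (le_of_eq ?_) (Finset.sum_le_sum_of_subset_of_nonneg hsub
      fun _ _ _ => by positivity)
    rw [Finset.sum_congr rfl (g := fun _ => ‖u n‖ ^ 2), Finset.sum_const, Finset.card_range,
      nsmul_eq_mul, mul_comm]
    intro v hv
    rw [Finset.mem_range] at hv
    have : (queryPosition m ((n + v : ℕ) : ZMod (2 * n)) : ℕ) = v := by
      simp only [queryPosition, ZMod.val_cast_of_lt (show n + v < 2 * n by omega)]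
      rw [if_neg (by omega)]; omega
    rw [this, Nat.cast_add, add_sub_cancel_right]

/-- A chain of polynomials of degree less than `m`, starting at the uniform one, consecutive ones
having the same modulus at the `m`-th roots of alternately `-1` and `1`, and ending at one whose
constant term has squared modulus at least `1 - ε`. -/
def HasPolynomialChain (m k : ℕ) [NeZero m] (ε : ℝ) : Prop :=
  ∃ g : ℕ → Fin m → ℂ, (g 0 = fun _ => ((1 / Real.sqrt m : ℝ) : ℂ)) ∧
    (∀ t < k, ∀ z : ℂ, z ^ m = (-1) ^ (t + 1) →
      ‖∑ a, g (t + 1) a * z ^ (a : ℕ)‖ = ‖∑ a, g t a * z ^ (a : ℕ)‖) ∧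
    1 - ε ≤ ‖g k 0‖ ^ 2

theorem hasPolynomialChain_of_hasTranslationInvariantAlgorithm {k : ℕ} {ε : ℝ} (hmn : m ≤ n)
    (h : HasTranslationInvariantAlgorithm n k ε) : HasPolynomialChain m k ε := by
  obtain ⟨A, hA, hsolve⟩ := h
  let u : ℕ → ZMod (2 * n) → ℂ := fun t =>
    if ht : t ≤ k then A.state (inputString n 0) t ht else 0
  have hu0 : u 0 = fun _ => ((1 / Real.sqrt (2 * n) : ℝ) : ℂ) := by
    rw [← hA.init_eq]
    simp [u, QueryAlgorithm.state]
  have hstep : ∀ t < k, ∃ c : ZMod (2 * n) → ℂ, circulant c ∈ unitaryGroup (ZMod (2 * n)) ℂ ∧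
      u (t + 1) = circulant c *ᵥ (phaseOracle (inputString n 0) *ᵥ u t) := fun t ht => by
    have hc := eq_circulant_of_translation_conj (hA.conj_translation ⟨t, ht⟩)
    refine ⟨fun i => (A.U ⟨t, ht⟩).1 i 0, hc ▸ (A.U ⟨t, ht⟩).2, ?_⟩
    rw [← hc]
    simp only [u, dif_pos (show t + 1 ≤ k from ht), dif_pos ht.le]
    rfl
  have hfin : 1 - ε ≤ ‖u k 0‖ ^ 2 + ‖u k n‖ ^ 2 := by
    have h0 := hsolve 0
    rw [hA.proj_eq, norm_sq_vecMulVec_measurementVector_mulVec] at h0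
    simp only [ZMod.val_zero, Nat.cast_zero, zero_add] at h0
    have hk : A.finalState (inputString n 0) = u k := by
      simp [u, QueryAlgorithm.finalState]
    rw [hk] at h0
    -- The success probability is `‖x ± y‖² / 2`, which is at most `‖x‖² + ‖y‖²`.
    have h1 := norm_add_le (u k 0) ((-1) ^ k * u k n)
    rw [norm_mul, norm_pow, norm_neg, norm_one, one_pow, one_mul] at h1
    have h2 := pow_le_pow_left₀ (norm_nonneg _) h1 2
    nlinarith [sq_nonneg (‖u k 0‖ - ‖u k n‖)]
  -- At `t = 0` the factor must be exactly the uniform vector, as the initial state is prescribed.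
  -- The Gram matrix is already of rank one there, so no factorization is needed.
  have hex : ∀ t, ∃ g : Fin m → ℂ,
      SameDiagonalSums (vecMulVec g (star g)) (simulationGram m ((-1) ^ t) (u t)) ∧
      (simulationGram m ((-1) ^ t) (u t) 0 0).re ≤ ‖g 0‖ ^ 2 ∧
      (t = 0 → g = fun _ => ((1 / Real.sqrt m : ℝ) : ℂ)) := fun t => by
    rcases Nat.eq_zero_or_pos t with rfl | ht
    · refine ⟨_, ?_, ?_, fun _ => rfl⟩
      · rw [pow_zero, hu0, simulationGram_const]
        exact fun _ => rfl
      · rw [pow_zero, hu0, simulationGram_const, vecMulVec_apply, Pi.star_apply, Complex.star_def,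
          Complex.mul_conj, Complex.ofReal_re, Complex.normSq_eq_norm_sq]
    · obtain ⟨g, h1, h2⟩ := exists_vector_sameDiagonalSums
        (posSemidef_simulationGram (m := m) ((-1) ^ t) (u t))
      exact ⟨g, h1, h2, fun h => absurd h ht.ne'⟩
  choose g hg1 hg2 hg3 using hex
  refine ⟨g, hg3 0 rfl, fun t ht z hzm => ?_, hfin.trans ((norm_sq_le_simulationGram hmn _ _).trans
    (hg2 k))⟩
  have hz : ‖z‖ = 1 := by
    have := congrArg norm hzm
    rw [norm_pow, norm_pow, norm_neg, norm_one, one_pow] at this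
    exact (pow_eq_one_iff_of_nonneg (norm_nonneg z) (NeZero.ne m)).1 this
  obtain ⟨c, hc, hcu⟩ := hstep t ht
  have hneg : ((-1 : ℂ)) ^ (t + 1) = -(-1) ^ t := by rw [pow_succ]; ring
  rw [← sq_eq_sq₀ (norm_nonneg _) (norm_nonneg _), norm_sq_eval_eq_of_sameDiagonalSums (hg1 _) hz,
    norm_sq_eval_eq_of_sameDiagonalSums (hg1 _) hz, hcu, hneg,
    sum_norm_sq_eval_localVector_step hmn hc (by rw [← mul_pow]; simp) hz (by rw [hzm, hneg])]

end Gram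

/-! ### From a polynomial chain to an algorithm for length `m`. -/

section Construction

variable {m : ℕ} [NeZero m]

/-- The vector on `ℤ/2m` whose two halves are `g` and `σ g`, normalized. -/
noncomputable def doubledVector (σ : ℂ) (g : Fin m → ℂ) : ZMod (2 * m) → ℂ :=
  fun i => ((1 / Real.sqrt 2 : ℝ) : ℂ) *
    ((if i.val < m then 1 else σ) * g ⟨i.val % m, Nat.mod_lt _ (NeZero.pos m)⟩)

theorem doubledVector_natCast (σ : ℂ) (g : Fin m → ℂ) (a : Fin m) :
    doubledVector σ g ((a : ℕ) : ZMod (2 * m)) = ((1 / Real.sqrt 2 : ℝ) : ℂ) * g a := by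
  have ha := a.2
  simp only [doubledVector, ZMod.val_cast_of_lt (show (a : ℕ) < 2 * m by omega),
    Nat.mod_eq_of_lt ha, if_pos ha, one_mul]

theorem doubledVector_add_natCast (σ : ℂ) (g : Fin m → ℂ) (a : Fin m) :
    doubledVector σ g ((m + a : ℕ) : ZMod (2 * m)) = ((1 / Real.sqrt 2 : ℝ) : ℂ) * (σ * g a) := by
  have ha := a.2
  simp only [doubledVector, ZMod.val_cast_of_lt (show m + (a : ℕ) < 2 * m by omega),
    Nat.add_mod_left, Nat.mod_eq_of_lt ha, if_neg (show ¬ m + (a : ℕ) < m by omega)]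

theorem phaseOracle_mulVec_doubledVector (σ : ℂ) (g : Fin m → ℂ) :
    phaseOracle (inputString m 0) *ᵥ doubledVector σ g = -doubledVector (-σ) g := by
  ext i
  simp only [phaseOracle, mulVec_diagonal, inputString, sub_zero, baseString, doubledVector,
    Pi.neg_apply]
  split_ifs with h <;> simp [h]

/-- For `σ = ±1` the first factor vanishes unless the root of unity `ω = stdAddChar (-k)` satisfies
`ω ^ m = σ`; on that support the transform samples the polynomial `g`. -/
theorem dft_doubledVector (σ : ℂ) (g : Fin m → ℂ) (k : ZMod (2 * m)) :
    dft (doubledVector σ g) k = ((1 / Real.sqrt 2 : ℝ) : ℂ) * ((1 + σ * stdAddChar (-k) ^ m) *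
      ∑ a, g a * stdAddChar (-k) ^ (a : ℕ)) := by
  have hpow : ∀ v : ℕ, stdAddChar (-((v : ZMod (2 * m)) * k)) = (stdAddChar (-k) : ℂ) ^ v :=
    fun v => by rw [← AddChar.map_nsmul_eq_pow, nsmul_eq_mul, mul_neg]
  rw [dft_apply, sum_zmod_two_mul, ← Fin.sum_univ_eq_sum_range
    (fun v => stdAddChar (-((v : ZMod (2 * m)) * k)) • doubledVector σ g v),
    ← Fin.sum_univ_eq_sum_range (fun v => stdAddChar (-(((m + v : ℕ) : ZMod (2 * m)) * k)) •
      doubledVector σ g ((m + v : ℕ) : ZMod (2 * m))), ← Finset.sum_add_distrib]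
  simp only [doubledVector_natCast, doubledVector_add_natCast, hpow, smul_eq_mul, Finset.mul_sum]
  refine Finset.sum_congr rfl fun a _ => ?_
  rw [pow_add]
  ring

/-- After the query both vectors have Fourier support in `ω ^ m = -σ`, exactly where the moduli of
`g` and `g'` agree. -/
theorem norm_dft_doubledVector_step {σ : ℂ} (hσ : σ * σ = 1) {g g' : Fin m → ℂ}
    (h : ∀ z : ℂ, z ^ m = -σ → ‖∑ a, g' a * z ^ (a : ℕ)‖ = ‖∑ a, g a * z ^ (a : ℕ)‖)
    (k : ZMod (2 * m)) :
    ‖dft (phaseOracle (inputString m 0) *ᵥ doubledVector σ g) k‖ =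
      ‖dft (doubledVector (-σ) g') k‖ := by
  rw [phaseOracle_mulVec_doubledVector, map_neg, Pi.neg_apply, norm_neg,
    dft_doubledVector, dft_doubledVector]
  by_cases hz : (stdAddChar (-k) : ℂ) ^ m = -σ
  · rw [norm_mul, norm_mul, norm_mul, norm_mul, h _ hz]
  · have h2 : ((stdAddChar (-k) : ℂ) ^ m + σ) * ((stdAddChar (-k) : ℂ) ^ m - σ) = 0 := by
      have h1 : ((stdAddChar (-k) : ℂ) ^ m) ^ 2 = 1 := by
        rw [← pow_mul, mul_comm m 2, ← AddChar.map_nsmul_eq_pow, nsmul_eq_mul, ZMod.natCast_self,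
          zero_mul, AddChar.map_zero_eq_one]
      linear_combination h1 - hσ
    have h3 : (stdAddChar (-k) : ℂ) ^ m - σ = 0 :=
      (mul_eq_zero.1 h2).resolve_left fun h => hz (eq_neg_of_add_eq_zero_left h)
    have h4 : 1 + -σ * (stdAddChar (-k) : ℂ) ^ m = 0 := by
      linear_combination -σ * h3 - hσ
    rw [h4]
    simp

/-- Translating the input translates the state, so the run on `w` determines the run on every `T^j
w`. -/
theorem mulVec_phaseOracle_translate (c v : ZMod (2 * m) → ℂ) (j : ZMod (2 * m)) :
    circulant c *ᵥ (phaseOracle (inputString m j) *ᵥ fun i => v (i - j)) =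
      fun i => (circulant c *ᵥ (phaseOracle (inputString m 0) *ᵥ v)) (i - j) := by
  ext i
  change ∑ x, c (i - x) * (phaseOracle (inputString m j) *ᵥ fun i => v (i - j)) x =
    ∑ x, c (i - j - x) * (phaseOracle (inputString m 0) *ᵥ v) x
  rw [← Equiv.sum_comp (Equiv.addRight j)]
  refine Finset.sum_congr rfl fun x _ => ?_
  simp only [Equiv.coe_addRight, phaseOracle, mulVec_diagonal, inputString, sub_zero, sub_sub,
    add_comm x j]
  simp only [add_sub_cancel_left]

theorem isStarProjection_vecMulVec_measurementVector (k : ℕ) (j : ZMod m) :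
    IsStarProjection (vecMulVec (measurementVector m k j) (star (measurementVector m k j))) := by
  refine ⟨?_, ?_⟩
  · rw [IsIdempotentElem, vecMulVec_mul_vecMulVec,
      star_measurementVector_dotProduct_measurementVector, if_pos rfl]
    simp
  · rw [IsSelfAdjoint, star_eq_conjTranspose, conjTranspose_vecMulVec, star_star]

theorem vecMulVec_measurementVector_mul (k : ℕ) {i j : ZMod m} (hij : i ≠ j) :
    vecMulVec (measurementVector m k i) (star (measurementVector m k i)) *
      vecMulVec (measurementVector m k j) (star (measurementVector m k j)) = 0 := by
  rw [vecMulVec_mul_vecMulVec, star_measurementVector_dotProduct_measurementVector, if_neg hij]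
  simp

theorem hasTranslationInvariantAlgorithm_of_hasPolynomialChain {k : ℕ} {ε : ℝ}
    (h : HasPolynomialChain m k ε) : HasTranslationInvariantAlgorithm m k ε := by
  obtain ⟨g, hg0, hstep, hfin⟩ := h
  have hσ : ∀ t : ℕ, ((-1 : ℂ)) ^ t * (-1) ^ t = 1 := fun t => by rw [← mul_pow]; simp
  have hneg : ∀ t : ℕ, ((-1 : ℂ)) ^ (t + 1) = -(-1) ^ t := fun t => by rw [pow_succ]; ring
  have hex : ∀ t : Fin k, ∃ c : ZMod (2 * m) → ℂ, circulant c ∈ unitaryGroup (ZMod (2 * m)) ℂ ∧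
      circulant c *ᵥ (phaseOracle (inputString m 0) *ᵥ doubledVector ((-1) ^ (t : ℕ)) (g t)) =
        doubledVector ((-1) ^ ((t : ℕ) + 1)) (g (t + 1)) := fun t => by
    refine exists_circulant_mem_unitaryGroup fun x => ?_
    rw [hneg]
    refine norm_dft_doubledVector_step (hσ t) (fun z hz => hstep t t.2 z ?_) x
    rw [hz, hneg]
  choose c hc hcv using hex
  have hm : (0 : ℝ) < m := Nat.cast_pos.2 (NeZero.pos m)
  let A : QueryAlgorithm m k :=
    { init := fun _ => ((1 / Real.sqrt (2 * m) : ℝ) : ℂ)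
      norm_init := by
        rw [← sq_eq_sq₀ (norm_nonneg _) zero_le_one, EuclideanSpace.norm_sq_eq]
        simp only [Complex.norm_real, Real.norm_eq_abs, sq_abs, div_pow, one_pow,
          Finset.sum_const, Finset.card_univ, ZMod.card, nsmul_eq_mul]
        rw [Real.sq_sqrt (by positivity)]
        push_cast
        field_simp
      U := fun t => ⟨circulant (c t), hc t⟩
      proj := fun j => vecMulVec (measurementVector m k j) (star (measurementVector m k j))
      isStarProjection_proj := isStarProjection_vecMulVec_measurementVector k
      proj_mul_proj := fun _ _ => vecMulVec_measurementVector_mul k }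
  have hstate : ∀ (j : ZMod (2 * m)) (t : ℕ) (ht : t ≤ k), A.state (inputString m j) t ht =
      fun i => doubledVector ((-1) ^ t) (g t) (i - j) := by
    intro j t
    induction t with
    | zero =>
      intro ht
      ext i
      simp only [QueryAlgorithm.state, A, doubledVector, hg0, pow_zero, ite_self, one_mul]
      rw [Real.sqrt_mul (by norm_num), ← one_div_mul_one_div, Complex.ofReal_mul]
    | succ t ih =>
      intro ht
      rw [QueryAlgorithm.state, ih]
      simp only [A]
      rw [mulVec_phaseOracle_translate, hcv ⟨t, ht⟩]
  refine ⟨A, ⟨rfl, fun t => translation_conj_circulant _, fun j => rfl⟩, fun j => ?_⟩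
  rw [QueryAlgorithm.finalState, hstate]
  refine hfin.trans (le_of_eq ?_)
  rw [show A.proj (j.val : ZMod m) = vecMulVec (measurementVector m k _)
    (star (measurementVector m k _)) from rfl, norm_sq_vecMulVec_measurementVector_mulVec,
    ZMod.val_natCast]
  have hj := ZMod.val_lt j
  have hzero := doubledVector_natCast ((-1) ^ k) (g k) 0
  have hhalf := doubledVector_add_natCast ((-1) ^ k) (g k) 0
  simp only [Fin.val_zero, Nat.cast_zero, add_zero] at hzero hhalf
  have hs : ‖((1 / Real.sqrt 2 : ℝ) : ℂ)‖ ^ 2 = 1 / 2 := by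
    rw [Complex.norm_real, Real.norm_eq_abs, sq_abs, div_pow, Real.sq_sqrt (by norm_num), one_pow]
  have hjc : j = ((j.val : ℕ) : ZMod (2 * m)) := (ZMod.natCast_zmod_val j).symm
  have hmm : (m : ZMod (2 * m)) + m = 0 := by
    rw [← two_mul]; exact_mod_cast ZMod.natCast_self (2 * m)
  -- The measured pair holds the amplitudes of the doubled vector at `0` and `m`, which interfere
  -- constructively thanks to the sign `(-1) ^ k`, so the probability is exactly `‖g k 0‖²`. For `j
  -- ≥ m` the two are swapped, which costs only a global sign.
  rcases lt_or_ge j.val m with hlt | hge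
  · have h1 : ((j.val % m : ℕ) : ZMod (2 * m)) - j = 0 := by
      rw [Nat.mod_eq_of_lt hlt, ← hjc, sub_self]
    have h2 : ((j.val % m + m : ℕ) : ZMod (2 * m)) - j = m := by
      rw [Nat.mod_eq_of_lt hlt, Nat.cast_add, ← hjc, add_sub_cancel_left]
    rw [h1, h2, hzero, hhalf]
    have : ((1 / Real.sqrt 2 : ℝ) : ℂ) * g k 0 +
        (-1) ^ k * (((1 / Real.sqrt 2 : ℝ) : ℂ) * ((-1) ^ k * g k 0)) =
        2 * (((1 / Real.sqrt 2 : ℝ) : ℂ) * g k 0) := by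
      linear_combination (((1 / Real.sqrt 2 : ℝ) : ℂ) * g k 0) * hσ k
    rw [this, norm_mul, norm_mul, mul_pow, mul_pow, hs]
    norm_num
    ring
  · have h0 : j.val % m = j.val - m := by
      rw [Nat.mod_eq_sub_mod hge, Nat.mod_eq_of_lt (by omega)]
    have h2 : ((j.val % m + m : ℕ) : ZMod (2 * m)) - j = 0 := by
      rw [h0, Nat.sub_add_cancel hge, ← hjc, sub_self]
    have h1 : ((j.val % m : ℕ) : ZMod (2 * m)) - j = m := by
      rw [Nat.cast_add] at h2
      linear_combination h2 - hmm
    rw [h1, h2, hzero, hhalf]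
    have : ((1 / Real.sqrt 2 : ℝ) : ℂ) * ((-1) ^ k * g k 0) +
        (-1) ^ k * (((1 / Real.sqrt 2 : ℝ) : ℂ) * g k 0) =
        2 * ((-1) ^ k * (((1 / Real.sqrt 2 : ℝ) : ℂ) * g k 0)) := by ring
    rw [this, norm_mul, norm_mul, norm_mul, norm_pow, mul_pow, mul_pow, mul_pow, hs]
    norm_num
    ring

end Construction

end OrderedSearch

theorem mainTheorem4 (ε : ℝ) (hε : 0 ≤ ε) (k n m : ℕ) [NeZero n] [NeZero m] (hmn : m < n)
    (h : OrderedSearch.HasTranslationInvariantAlgorithm n k ε) :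
    OrderedSearch.HasTranslationInvariantAlgorithm m k ε :=
  OrderedSearch.hasTranslationInvariantAlgorithm_of_hasPolynomialChain
    (OrderedSearch.hasPolynomialChain_of_hasTranslationInvariantAlgorithm hmn.le h)
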